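/- Assume Jensen's principle $\Diamond$: there is a sequence $\langle A_\alpha:\alpha<\omega_1\rangle$ with $A_\alpha\subseteq\alpha$ such that for every $X\subseteq\omega_1$ the set $\{\alpha<\omega_1: X\cap\alpha=A_\alpha\}$ is stationary in $\omega_1$. For ultrafilters $\mathcal U,\mathcal V$ on $\omega$ write $\mathcal U\leq_{RK}\mathcal V$ if there is a function $f:\omega\to\omega$ with $\mathcal U=\{X\subseteq\omega: f^{-1}[X]\in\mathcal V\}$, and $\mathcal U<_{RK}\mathcal V$ if $\mathcal U\leq_{RK}\mathcal V$ and $\mathcal V\not\leq_{RK}\mathcal U$. A nonprincipal ultrafilter $\mathcal U$ on $\omega$ is a P-point if for every sequence $\langle X_n:n<\omega\rangle$ of elements of $\mathcal U$ there is $X\in\mathcal U$ such that $X\setminus X_n$ is finite for every $n$. Then there is a sequence $\langle\mathcal U_\alpha:\alpha<\omega_1\rangle$ of P-points such that $\mathcal U_\alpha<_{RK}\mathcal U_\beta$ whenever $\alpha<\beta<\omega_1$, and there is no P-point $\mathcal V$ with $\mathcal U_\alpha\leq_{RK}\mathcal V$ for all $\alpha<\omega_1$. -/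

import Mathlib

/-- The well-ordered set of all countable ordinals, i.e. the ordinal `ω₁`. -/
abbrev OmegaOne : Type 1 := Set.Iio (Ordinal.omega.{0} 1)

/-- Jensen's diamond principle: there are sets `A α ⊆ α` (`α < ω₁`) such that every `X ⊆ ω₁`
satisfies `X ∩ α = A α` for stationarily many `α < ω₁`. -/
def JensenDiamond : Prop :=
  ∃ A : OmegaOne → Set OmegaOne, (∀ α, A α ⊆ Set.Iio α) ∧
    ∀ X : Set OmegaOne, IsStationary {α : OmegaOne | X ∩ Set.Iio α = A α}

/-- The Rudin–Keisler (pre)order on ultrafilters on `ω`: `U ≤ V` iff `U` is the image of `V` under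
some function, i.e. `X ∈ U ↔ f ⁻¹' X ∈ V` for all `X`. -/
def RKLE (U V : Ultrafilter ℕ) : Prop :=
  ∃ f : ℕ → ℕ, U = Ultrafilter.map f V

/-- The strict part of the Rudin–Keisler order. -/
def RKLT (U V : Ultrafilter ℕ) : Prop :=
  RKLE U V ∧ ¬ RKLE V U

/-- A P-point: a nonprincipal ultrafilter on `ω` in which every sequence of members has a
pseudointersection that is again a member. -/
structure IsPPoint (U : Ultrafilter ℕ) : Prop where
  nonprincipal : ∀ n : ℕ, ({n} : Set ℕ) ∉ U
  pseudoInter : ∀ X : ℕ → Set ℕ, (∀ n, X n ∈ U) → ∃ Y ∈ U, ∀ n, (Y \ X n).Finite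

open Set

/-! Diamond enters only through the continuum hypothesis. Under it, P-points arise from mod-finite
decreasing towers of "positive" sets of length ω₁. Fix a P-point `S` whose members are arbitrarily
sparse. A P-point above `S` has, up to its members, only one projection to `S`, so fiber sizes over
`S` behave as an invariant. On some member of a P-point `V` these fibers are finite, so their sizes
are given by a function `b`; a P-point all of whose members have fibers exceeding `b` cannot lie
below `V`. Every P-point above `S` has extensions with fibers as large as desired, and countable
chains have P-point bounds. The ω₁-chain exceeds the `i`-th function in an enumeration of all
functions at stage `i`, so no `V` bounds it. -/

theorem exists_chain {ι Q : Type*} [LinearOrder ι] [WellFoundedLT ι] [Nonempty Q]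
    (hι : ∀ i : ι, (Iio i).Countable) (r : Q → Q → Prop) (hrefl : ∀ q, r q q)
    (htrans : ∀ a b c, r a b → r b c → r a c)
    (hσ : ∀ s : ℕ → Q, (∀ n, r (s n) (s (n + 1))) → ∃ q, ∀ n, r (s n) q)
    (D : ι → Q → Q → Prop) (hD : ∀ i q, ∃ q', r q q' ∧ D i q q') :
    ∃ p : ι → Q, ∀ i, ∃ q, (∀ j < i, r (p j) q) ∧ r q (p i) ∧ D i q (p i) := by
  choose next hnext using hD
  let F : (i : ι) → ((j : ι) → j < i → Q) → Q := fun i prev =>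
    next i (Classical.epsilon fun q => ∀ j (h : j < i), r (prev j h) q)
  let p : ι → Q := (wellFounded_lt (α := ι)).fix F
  have hp : ∀ i, p i = next i (Classical.epsilon fun q => ∀ j, j < i → r (p j) q) := fun i =>
    (wellFounded_lt (α := ι)).fix_eq F i
  -- The recursion picks a bound of the earlier values, junk if there is none. One always exists: a
  -- countable directed initial segment has a cofinal sequence.
  have key : ∀ i, ∃ q, ∀ j, j < i → r (p j) q := by
    intro i
    induction i using WellFoundedLT.induction with
    | ind i ih =>
      rcases isEmpty_or_nonempty (Iio i) with hemp | hne
      · exact ⟨Classical.arbitrary Q, fun j hj => (hemp.false ⟨j, hj⟩).elim⟩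
      have hmono : ∀ a b : Iio i, a ≤ b → r (p a) (p b) := by
        intro a b hab
        rcases hab.eq_or_lt with rfl | hab
        · exact hrefl _
        · rw [hp b]
          exact htrans _ _ _ (Classical.epsilon_spec (ih b b.2) a hab) (hnext _ _).1
      have hdir : Directed r fun a : Iio i => p a := fun a b =>
        ⟨max a b, hmono _ _ (le_max_left _ _), hmono _ _ (le_max_right _ _)⟩
      have := (hι i).to_subtype
      let _ := Encodable.ofCountable (Iio i)
      let _ : Inhabited (Iio i) := Classical.inhabited_of_nonempty hne
      obtain ⟨q, hq⟩ := hσ _ (fun n => hdir.sequence_mono_nat n)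
      exact ⟨q, fun j hj => htrans _ _ _ (hdir.rel_sequence ⟨j, hj⟩) (hq _)⟩
  refine ⟨p, fun i => ⟨_, Classical.epsilon_spec (key i), ?_⟩⟩
  rw [hp i]
  exact hnext i _

/-! ### Countable ordinals and the continuum hypothesis -/

theorem OmegaOne.countable_Iio (a : OmegaOne) : (Iio a).Countable := by
  have h : (Iio a.1).Countable := by
    rw [← Cardinal.le_aleph0_iff_set_countable, Cardinal.mk_Iio_ordinal,
      Cardinal.lift_le_aleph0, ← Order.lt_succ_iff, Cardinal.succ_aleph0,
      ← Cardinal.lt_ord, Cardinal.ord_aleph]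
    exact a.2
  exact h.preimage_of_injOn (f := Subtype.val) Subtype.val_injective.injOn

theorem OmegaOne.not_countable : ¬ (univ : Set OmegaOne).Countable := by
  rw [← Cardinal.le_aleph0_iff_set_countable, Cardinal.mk_univ, Cardinal.mk_Iio_ordinal,
      Cardinal.lift_le_aleph0, Ordinal.card_omega, not_le]
  exact Cardinal.aleph0_lt_aleph_one

theorem OmegaOne.exists_forall_lt (f : ℕ → OmegaOne) : ∃ a, ∀ n, f n < a := by
  by_contra! h
  refine OmegaOne.not_countable ((countable_iUnion fun n =>
    ((OmegaOne.countable_Iio (f n)).union (countable_singleton (f n)))).mono fun a _ => ?_)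
  obtain ⟨n, hn⟩ := h a
  simp only [mem_iUnion]
  exact ⟨n, hn.lt_or_eq⟩

theorem JensenDiamond.exists_surjective_set (h : JensenDiamond) :
    ∃ f : OmegaOne → Set ℕ, Function.Surjective f := by
  obtain ⟨A, -, hA⟩ := h
  let e : ℕ → OmegaOne := fun n =>
    ⟨n, (Ordinal.natCast_lt_omega0 n).trans Ordinal.omega0_lt_omega_one⟩
  have he : Function.Injective e := fun m n hmn => by
    have := congrArg Subtype.val hmn
    simpa [e] using this
  let w : OmegaOne := ⟨Ordinal.omega0, Ordinal.omega0_lt_omega_one⟩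
  refine ⟨fun a => e ⁻¹' A a, fun Z => ?_⟩
  -- Guessing at some `a ≥ ω` captures all of `Z`, not just an initial part.
  have hclub : IsClub (Ici w) := by
    refine ⟨?_, fun a => ⟨max a w, mem_Ici.2 (le_max_right _ _), le_max_left _ _⟩⟩
    intro s hs hne _ a ha
    obtain ⟨x, hx⟩ := hne
    exact (hs hx : w ≤ x).trans (ha.1 hx)
  obtain ⟨a, ha, haw⟩ := hA (e '' Z) hclub
  refine ⟨a, ?_⟩
  have haw : w ≤ a := haw
  have ha : e '' Z ∩ Iio a = A a := ha
  have hea : ∀ n, e n < a := fun n =>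
    lt_of_lt_of_le (show e n < w from Ordinal.natCast_lt_omega0 n) haw
  ext n
  simp [← ha, he.mem_set_image, hea n]

theorem JensenDiamond.exists_surjective (h : JensenDiamond) {T : Type} [Nonempty T]
    (hT : Cardinal.mk T ≤ Cardinal.continuum) :
    ∃ f : OmegaOne → T, Function.Surjective f := by
  obtain ⟨f, hf⟩ := h.exists_surjective_set
  rw [← Cardinal.mk_set_nat] at hT
  obtain ⟨i⟩ := hT
  exact ⟨_, (Function.invFun_surjective i.injective).comp hf⟩

/-! ### P-points from towers -/

/-- A tower of positive sets deciding every `e i` generates an ultrafilter. Countably many members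
are each witnessed at a countable stage, and any later stage is a pseudointersection of them. -/
theorem exists_isPPoint_of_positive {e : OmegaOne → Set ℕ} (he : Function.Surjective e)
    (P : Set ℕ → Prop) (huniv : P univ) (hempty : ¬ P ∅)
    (hmod : ∀ X Y, P X → (X \ Y).Finite → P Y)
    (hσ : ∀ X : ℕ → Set ℕ, Antitone X → (∀ n, P (X n)) → ∃ Y, P Y ∧ ∀ n, (Y \ X n).Finite)
    (hsplit : ∀ X Z, P X → P (X ∩ Z) ∨ P (X \ Z))
    (E : OmegaOne → Set ℕ → Prop) (hE : ∀ i X, P X → ∃ Y ⊆ X, P Y ∧ E i Y) :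
    ∃ W : Ultrafilter ℕ, IsPPoint W ∧ (∀ Y ∈ W, P Y) ∧ ∀ i, ∃ Y ∈ W, E i Y := by
  have hdt : ∀ {A B C : Set ℕ}, (B \ A).Finite → (C \ B).Finite → (C \ A).Finite := by
    intro A B C h1 h2
    exact (h1.union h2).subset fun x hx => by
      by_cases hB : x ∈ B
      · exact .inl ⟨hB, hx.2⟩
      · exact .inr ⟨hx.1, hB⟩
  have : Nonempty {X // P X} := ⟨⟨univ, huniv⟩⟩
  have hchain := exists_chain (ι := OmegaOne) (Q := {X // P X}) OmegaOne.countable_Iio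
    (fun X Y => (Y.1 \ X.1).Finite) (fun X => by simp) (fun A B C => hdt) ?_
    (fun i _ Y => (Y.1 ⊆ e i ∨ Y.1 ⊆ (e i)ᶜ) ∧ E i Y.1) ?_
  · obtain ⟨T, hT⟩ := hchain
    have hmono : ∀ i j, i ≤ j → ((T j).1 \ (T i).1).Finite := by
      intro i j hij
      rcases hij.eq_or_lt with rfl | hij
      · simp
      · obtain ⟨q, h1, h2, -⟩ := hT j
        exact hdt (h1 i hij) h2
    let F : Filter ℕ :=
      { sets := {Z | ∃ i, ((T i).1 \ Z).Finite}
        univ_sets := ⟨⟨0, Ordinal.omega_pos 1⟩, by simp⟩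
        sets_of_superset := by
          rintro x y ⟨i, hi⟩ hxy
          exact ⟨i, hi.subset (sdiff_subset_sdiff_right hxy)⟩
        inter_sets := by
          rintro x y ⟨i, hi⟩ ⟨j, hj⟩
          refine ⟨max i j, ?_⟩
          rw [sdiff_inter]
          exact (hdt hi (hmono _ _ (le_max_left _ _))).union
            (hdt hj (hmono _ _ (le_max_right _ _))) }
    have hFP : ∀ Z ∈ F, P Z := fun Z ⟨i, hi⟩ => hmod _ _ (T i).2 hi
    have hfin : ∀ Z : Set ℕ, Z.Finite → Z ∉ F := fun Z hZ hF =>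
      hempty (hmod _ _ (hFP Z hF) (by simpa using hZ))
    have hult : ∀ s : Set ℕ, sᶜ ∉ F ↔ s ∈ F := by
      intro s
      constructor
      · intro hs
        obtain ⟨i, rfl⟩ := he s
        obtain ⟨q, -, -, h | h, -⟩ := hT i
        · exact ⟨i, by simp [sdiff_eq_empty.2 h]⟩
        · exact (hs ⟨i, by simp [sdiff_eq_empty.2 h]⟩).elim
      · intro hs hs'
        exact hfin ∅ finite_empty (by simpa using Filter.inter_mem hs hs')
    refine ⟨Ultrafilter.ofComplNotMemIff F hult, ⟨fun n => hfin _ (finite_singleton n), ?_⟩,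
      hFP, ?_⟩
    · intro X hX
      choose i hi using hX
      obtain ⟨a, ha⟩ := OmegaOne.exists_forall_lt i
      exact ⟨(T a).1, ⟨a, by simp⟩, fun n => hdt (hi n) (hmono _ _ (ha n).le)⟩
    · intro i
      obtain ⟨q, -, -, -, h⟩ := hT i
      exact ⟨(T i).1, ⟨i, by simp⟩, h⟩
  · intro s hs
    -- Finite intersections turn mod-finite decrease into true decrease, changing each term only
    -- finitely.
    let X : ℕ → Set ℕ := fun n => ⋂ k ∈ Iic n, (s k).1
    have hX : ∀ n, ((s n).1 \ X n).Finite := by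
      have hs' : ∀ n k, k ≤ n → ((s n).1 \ (s k).1).Finite := by
        intro n k hk
        induction n, hk using Nat.le_induction with
        | base => simp
        | succ n _ ih => exact hdt ih (hs n)
      intro n
      simp only [X, sdiff_iInter]
      exact (finite_Iic n).biUnion fun k hk => hs' n k hk
    obtain ⟨Y, hY, hYX⟩ := hσ X
      (fun m n hmn => biInter_subset_biInter_left (Iic_subset_Iic.2 hmn))
      (fun n => hmod _ _ (s n).2 (hX n))
    exact ⟨⟨Y, hY⟩, fun n => (hYX n).subset
      (sdiff_subset_sdiff_right (biInter_subset_of_mem (mem_Iic.2 le_rfl)))⟩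
  · rintro i ⟨X, hX⟩
    rcases hsplit X (e i) hX with h | h
    · obtain ⟨Y, hYX, hY, hEY⟩ := hE i _ h
      exact ⟨⟨Y, hY⟩, by simp [sdiff_eq_empty.2 (hYX.trans inter_subset_left)],
        .inl (hYX.trans inter_subset_right), hEY⟩
    · obtain ⟨Y, hYX, hY, hEY⟩ := hE i _ h
      exact ⟨⟨Y, hY⟩, by simp [sdiff_eq_empty.2 (hYX.trans sdiff_subset)],
        .inr (hYX.trans fun x hx => hx.2), hEY⟩

/-! ### Finite-to-one projections and diagonalization -/

theorem Ultrafilter.eq_map_of_forall_preimage {U V : Ultrafilter ℕ} {f : ℕ → ℕ}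
    (h : ∀ B, f ⁻¹' B ∈ V → B ∈ U) : U = Ultrafilter.map f V :=
  Ultrafilter.coe_le_coe.1 fun B hB => h B hB

theorem IsPPoint.finite_notMem {U : Ultrafilter ℕ} (hU : IsPPoint U) {Z : Set ℕ}
    (hZ : Z.Finite) : Z ∉ U := by
  intro h
  obtain ⟨n, -, hn⟩ := (Ultrafilter.finite_biUnion_mem_iff hZ (s := fun n => {n})).1 (by simpa)
  exact hU.nonprincipal n hn

theorem IsPPoint.diff_mem {U : Ultrafilter ℕ} (hU : IsPPoint U) {X Z : Set ℕ} (hX : X ∈ U)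
    (hZ : Z.Finite) : X \ Z ∈ U :=
  Filter.inter_mem hX (Ultrafilter.compl_mem_iff_notMem.2 (hU.finite_notMem hZ))

theorem IsPPoint.exists_finite_preimage {U V : Ultrafilter ℕ} (hV : IsPPoint V)
    (hU : ∀ n : ℕ, ({n} : Set ℕ) ∉ U) {f : ℕ → ℕ} (hf : Ultrafilter.map f V = U) :
    ∃ X ∈ V, ∀ j, {x ∈ X | f x = j}.Finite := by
  obtain ⟨X, hX, h⟩ := hV.pseudoInter (fun n => (f ⁻¹' {n})ᶜ) fun n => by
    rw [Ultrafilter.compl_mem_iff_notMem, ← Ultrafilter.mem_map, hf]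
    exact hU n
  refine ⟨X, hX, fun j => (h j).subset fun x hx => ?_⟩
  simpa using hx

theorem IsPPoint.exists_tendsto_index {U : Ultrafilter ℕ} (hU : IsPPoint U) {B : ℕ → Set ℕ}
    (hB : ∀ k, B k ∈ U) (c : ℕ) :
    ∃ A ∈ U, ∃ κ : ℕ → ℕ, (∀ i ∈ A, i ∈ B (κ i) ∧ c ≤ κ i) ∧
      ∀ k, {i ∈ A | κ i < k}.Finite := by
  classical
  obtain ⟨A, hA, hAB⟩ := hU.pseudoInter B hB
  let κ : ℕ → ℕ := fun i => Nat.findGreatest (fun k => i ∈ B k) i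
  have hfin : ∀ k, {i ∈ A | κ i < k}.Finite := by
    intro k
    refine ((hAB k).union (finite_Iio k)).subset fun i hi => ?_
    by_contra hc
    simp only [mem_union, mem_sdiff, mem_Iio, not_or, not_and, not_not, not_lt] at hc
    exact absurd hi.2 (not_lt.2 (Nat.le_findGreatest hc.2 (hc.1 hi.1)))
  -- `B 0` is needed because `Nat.findGreatest` defaults to 0.
  refine ⟨(A ∩ B 0) \ {i ∈ A | κ i < c}, hU.diff_mem (Filter.inter_mem hA (hB 0)) (hfin c), κ,
    fun i hi => ⟨?_, ?_⟩, fun k => (hfin k).subset fun i hi => ⟨hi.1.1.1, hi.2⟩⟩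
  · exact Nat.findGreatest_spec (P := fun k => i ∈ B k) (Nat.zero_le i) hi.1.2
  · by_contra hc
    exact hi.2 ⟨hi.1.1, not_le.1 hc⟩

/-! ### A P-point with sparse members -/

theorem exists_strictMono_mem_and_lt {X : ℕ → Set ℕ} (hX : ∀ n, (X n).Infinite) (b : ℕ → ℕ) :
    ∃ y : ℕ → ℕ, StrictMono y ∧ (∀ n, y n ∈ X n) ∧ ∀ m n, m < n → b (y m) < y n := by
  choose next hmem hlt using fun n m => (hX n).exists_gt m
  let y : ℕ → ℕ := fun n => Nat.rec (next 0 0)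
    (fun n x => next (n + 1) (x + ∑ k ∈ Finset.range (x + 1), b k)) n
  have hstep : ∀ n, y n + ∑ k ∈ Finset.range (y n + 1), b k < y (n + 1) := fun n => hlt _ _
  have hy : StrictMono y := strictMono_nat_of_lt_succ fun n => by have := hstep n; omega
  refine ⟨y, hy, fun n => ?_, fun m n hmn => ?_⟩
  · cases n <;> exact hmem _ _
  · obtain ⟨k, rfl⟩ := Nat.exists_eq_add_of_lt hmn
    have h1 := hstep (m + k)
    have h2 : b (y m) ≤ ∑ k ∈ Finset.range (y (m + k) + 1), b k :=
      Finset.single_le_sum (f := b) (fun _ _ => Nat.zero_le _)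
        (Finset.mem_range.2 (Nat.lt_succ_of_le (hy.monotone (Nat.le_add_right m k))))
    omega

/-- Members of the ultrafilter grow faster than any prescribed function; for a P-point this is
the property of being selective. -/
def HasSparseMembers (S : Ultrafilter ℕ) : Prop :=
  ∀ b : ℕ → ℕ, ∃ A ∈ S, ∀ m ∈ A, ∀ n ∈ A, m < n → b m < n

theorem JensenDiamond.exists_isPPoint_hasSparseMembers (h : JensenDiamond) :
    ∃ S, IsPPoint S ∧ HasSparseMembers S := by
  obtain ⟨f, hf⟩ := h.exists_surjective (T := Set ℕ × (ℕ → ℕ)) (by simp)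
  obtain ⟨S, hS, -, hE⟩ := exists_isPPoint_of_positive (e := fun i => (f i).1)
    (Prod.fst_surjective.comp hf) Set.Infinite infinite_univ (by simp)
    (fun X Y hX h hY => hX ((h.union hY).subset (by simp)))
    (fun X hX hinf => by
      obtain ⟨y, hy, hmem, -⟩ := exists_strictMono_mem_and_lt hinf id
      refine ⟨range y, infinite_range_of_injective hy.injective, fun n => ?_⟩
      refine ((finite_Iio n).image y).subset ?_
      rintro _ ⟨⟨k, rfl⟩, hk⟩
      exact ⟨k, not_le.1 fun hnk => hk (hX hnk (hmem k)), rfl⟩)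
    (fun X Z hX => by
      by_contra hc
      rw [not_or, not_infinite, not_infinite] at hc
      exact hX (by simpa using hc.1.union hc.2))
    (fun i Y => ∀ m ∈ Y, ∀ n ∈ Y, m < n → (f i).2 m < n)
    (fun i X hX => by
      obtain ⟨y, hy, hmem, hlt⟩ := exists_strictMono_mem_and_lt (fun _ => hX) (f i).2
      refine ⟨range y, range_subset_iff.2 hmem, infinite_range_of_injective hy.injective, ?_⟩
      rintro _ ⟨m, rfl⟩ _ ⟨n, rfl⟩ hmn
      exact hlt m n (hy.lt_iff_lt.1 hmn))
  refine ⟨S, hS, fun b => ?_⟩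
  obtain ⟨i, hi⟩ := hf (∅, b)
  simpa [hi] using hE i

/-- Both maps are finite-to-one on a member, so each value bounds the other; a sparse member of `S`
has no two distinct points that close. -/
theorem HasSparseMembers.eqOn_of_map_eq {S V : Ultrafilter ℕ} (hSs : HasSparseMembers S)
    (hS : IsPPoint S) (hV : IsPPoint V) {f g : ℕ → ℕ}
    (hf : Ultrafilter.map f V = S) (hg : Ultrafilter.map g V = S) :
    ∃ X ∈ V, ∀ x ∈ X, f x = g x := by
  obtain ⟨X, hX, hXf⟩ := hV.exists_finite_preimage hS.nonprincipal hf
  obtain ⟨Y, hY, hYg⟩ := hV.exists_finite_preimage hS.nonprincipal hg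
  choose a ha using fun j => ((hXf j).image g).bddAbove
  choose c hc using fun j => ((hYg j).image f).bddAbove
  obtain ⟨A, hA, hAb⟩ := hSs fun j => max (a j) (c j)
  refine ⟨X ∩ Y ∩ (f ⁻¹' A ∩ g ⁻¹' A), Filter.inter_mem (Filter.inter_mem hX hY)
    (Filter.inter_mem (by rwa [← hf] at hA) (by rwa [← hg] at hA)), ?_⟩
  rintro x ⟨⟨hxX, hxY⟩, hxf, hxg⟩
  rcases lt_trichotomy (f x) (g x) with h | h | h
  · have h1 := hAb _ hxf _ hxg h
    have h2 : g x ≤ a (f x) := ha (f x) ⟨x, ⟨hxX, rfl⟩, rfl⟩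
    omega
  · exact h
  · have h1 := hAb _ hxg _ hxf h
    have h2 : f x ≤ c (g x) := hc (g x) ⟨x, ⟨hxY, rfl⟩, rfl⟩
    omega

/-! ### Bounds of countable chains -/

/-- The composition `p m ∘ p (m + 1) ∘ ⋯ ∘ p (m + d - 1)`. -/
def compFrom (p : ℕ → ℕ → ℕ) : ℕ → ℕ → ℕ → ℕ
  | _, 0, i => i
  | m, d + 1, i => p m (compFrom p (m + 1) d i)

/-- The projection to level `m` of the disjoint union of the levels of an inverse sequence, where
`Nat.pair n i` codes the point `i` of level `n`. -/
def levelProj (p : ℕ → ℕ → ℕ) (m x : ℕ) : ℕ :=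
  compFrom p m (x.unpair.1 - m) x.unpair.2

theorem levelProj_of_lt (p : ℕ → ℕ → ℕ) {m x : ℕ} (h : m < x.unpair.1) :
    levelProj p m x = p m (levelProj p (m + 1) x) := by
  have : x.unpair.1 - m = (x.unpair.1 - (m + 1)) + 1 := by omega
  rw [levelProj, this, compFrom, levelProj]

theorem levelProj_pair_self (p : ℕ → ℕ → ℕ) (m i : ℕ) : levelProj p m (Nat.pair m i) = i := by
  simp [levelProj, compFrom]

/-- Positive sets have large image at every level. Smallness at one level passes to all higher ones,
which gives splitting. -/
theorem JensenDiamond.exists_isPPoint_bound (h : JensenDiamond) {U : ℕ → Ultrafilter ℕ}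
    (hU : ∀ n, IsPPoint (U n)) (hle : ∀ n, RKLE (U n) (U (n + 1))) :
    ∃ W, IsPPoint W ∧ ∀ n, RKLE (U n) W := by
  choose p hp using hle
  obtain ⟨e, he⟩ := h.exists_surjective_set
  let π : ℕ → ℕ → ℕ := levelProj p
  let img : ℕ → Set ℕ → Set ℕ := fun m X => π m '' {x ∈ X | m ≤ x.unpair.1}
  have himg_mono : ∀ m {X Y : Set ℕ}, X ⊆ Y → img m X ⊆ img m Y := fun m X Y hXY =>
    image_mono fun x hx => ⟨hXY hx.1, hx.2⟩
  have himg_union : ∀ m X Y, img m (X ∪ Y) = img m X ∪ img m Y := by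
    intro m X Y
    simp only [img, ← image_union]
    congr 1
    ext x
    simp only [mem_union, mem_ofPred_eq, or_and_right]
  have hstep : ∀ m X, img (m + 1) X ∈ U (m + 1) → img m X ∈ U m := by
    intro m X hX
    rw [hp m, Ultrafilter.mem_map]
    refine Filter.mem_of_superset hX ?_
    rintro _ ⟨x, ⟨hx, hm⟩, rfl⟩
    exact ⟨x, ⟨hx, by omega⟩, levelProj_of_lt p hm⟩
  have hdown : ∀ m n X, m ≤ n → img n X ∈ U n → img m X ∈ U m := by
    intro m n X hmn
    induction n, hmn using Nat.le_induction with
    | base => exact id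
    | succ n _ ih => exact fun hX => ih (hstep n X hX)
  obtain ⟨W, hW, hWP, -⟩ := exists_isPPoint_of_positive he (fun X => ∀ m, img m X ∈ U m)
    (fun m => Filter.mem_of_superset Filter.univ_mem fun i _ =>
      ⟨Nat.pair m i, ⟨mem_univ _, by simp⟩, levelProj_pair_self p m i⟩)
    (fun hc => by simpa [img] using hc 0)
    (fun X Y hX hfin m => by
      refine Filter.mem_of_superset ((hU m).diff_mem (hX m) (hfin.image (π m))) ?_
      rintro _ ⟨⟨x, ⟨hx, hm⟩, rfl⟩, hn⟩
      exact ⟨x, ⟨by_contra fun hY => hn ⟨x, ⟨hx, hY⟩, rfl⟩, hm⟩, rfl⟩)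
    (fun X hX hpos => by
      choose A hA κ hκ hfin using fun m =>
        (hU m).exists_tendsto_index (B := fun k => img m (X k)) (fun k => hpos k m) m
      choose! y hy hyi using fun m i (hi : i ∈ A m) => (hκ m i hi).1
      refine ⟨⋃ m, y m '' A m, fun m => Filter.mem_of_superset (hA m) fun i hi => ?_, fun k => ?_⟩
      · exact ⟨y m i, ⟨mem_iUnion.2 ⟨m, i, hi, rfl⟩, (hy m i hi).2⟩, hyi m i hi⟩
      -- Since `m ≤ κ m i`, only levels below `k` leave `X k`, each finitely often.
      · refine ((finite_Iio k).biUnion fun m _ => (hfin m k).image (y m)).subset ?_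
        rintro _ ⟨hx, hk⟩
        obtain ⟨m, i, hi, rfl⟩ := mem_iUnion.1 hx
        have hlt : κ m i < k := not_le.1 fun hle => hk (hX hle (hy m i hi).1)
        exact mem_biUnion (mem_Iio.2 ((hκ m i hi).2.trans_lt hlt)) ⟨i, ⟨hi, hlt⟩, rfl⟩)
    (fun X Z hX => by
      by_contra! hc
      obtain ⟨⟨m, hm⟩, n, hn⟩ := hc
      have hmn := hX (max m n)
      rw [← inter_union_sdiff X Z, himg_union, Ultrafilter.union_mem_iff] at hmn
      rcases hmn with h' | h'
      · exact hm (hdown _ _ _ (le_max_left _ _) h')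
      · exact hn (hdown _ _ _ (le_max_right _ _) h'))
    (fun _ _ => True) (fun _ X hX => ⟨X, Subset.rfl, hX, trivial⟩)
  refine ⟨W, hW, fun n => ⟨π n, Ultrafilter.eq_map_of_forall_preimage fun B hB => ?_⟩⟩
  refine Filter.mem_of_superset (hWP _ hB n) ?_
  rintro _ ⟨x, ⟨hx, -⟩, rfl⟩
  exact hx

/-! ### Extensions with large fibers -/

theorem JensenDiamond.exists_isPPoint_large_fibers (h : JensenDiamond) {U : Ultrafilter ℕ}
    (hU : IsPPoint U) (g : ℕ → ℕ) :
    ∃ W, IsPPoint W ∧ ∃ π : ℕ → ℕ, U = Ultrafilter.map π W ∧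
      ∀ Y ∈ W, {i | (g i : ℕ∞) < {y ∈ Y | π y = i}.encard} ∈ U := by
  classical
  obtain ⟨e, he⟩ := h.exists_surjective_set
  -- Halving a fiber costs one factor of 2, so positivity asks for every power; truncating at `N i`
  -- keeps fibers finite yet eventually large enough.
  let N : ℕ → ℕ := fun i => (g i + 1) * 2 ^ i
  let fib : Set ℕ → ℕ → Finset ℕ := fun X i => {j ∈ Finset.range (N i) | Nat.pair i j ∈ X}
  let P : Set ℕ → Prop := fun X => ∀ k, {i | (g i + 1) * 2 ^ k ≤ (fib X i).card} ∈ U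
  have hencard : ∀ X i, ((fib X i).card : ℕ∞) ≤ {y ∈ X | y.unpair.1 = i}.encard := by
    intro X i
    rw [← Set.encard_coe_eq_coe_finsetCard]
    refine encard_le_encard_of_injOn (f := Nat.pair i) (fun j hj => ?_) fun a _ b _ hab => ?_
    · simp only [fib, Finset.coe_filter, mem_ofPred_eq] at hj
      exact ⟨hj.2, by simp⟩
    · exact (Nat.pair_eq_pair.1 hab).2
  obtain ⟨W, hW, hWP, -⟩ := exists_isPPoint_of_positive he P
    (fun k => by
      refine Filter.mem_of_superset (hU.diff_mem Filter.univ_mem (finite_Iio k)) fun i hi => ?_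
      have hki : k ≤ i := by simpa using hi
      simp only [fib, N, mem_univ, Finset.filter_true, Finset.card_range, mem_ofPred_eq]
      gcongr
      norm_num)
    (fun hc => by simpa [fib] using hc 0)
    (fun X Y hX hfin k => by
      refine Filter.mem_of_superset
        (hU.diff_mem (hX k) (hfin.image fun x => x.unpair.1)) fun i hi => ?_
      refine le_trans (b := (fib X i).card) hi.1 ?_
      refine Finset.card_le_card fun j hj => ?_
      simp only [fib, Finset.mem_filter] at hj ⊢
      exact ⟨hj.1, by_contra fun hY => hi.2 ⟨_, ⟨hj.2, hY⟩, by simp⟩⟩)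
    (fun X hX hpos => by
      obtain ⟨A, hA, κ, hκ, hfin⟩ := hU.exists_tendsto_index
        (B := fun k => {i | (g i + 1) * 2 ^ k ≤ (fib (X k) i).card}) (fun k => hpos k k) 0
      let Y : Set ℕ := {x | x.unpair.1 ∈ A ∧ x.unpair.2 < N x.unpair.1 ∧ x ∈ X (κ x.unpair.1)}
      refine ⟨Y, fun k => ?_, fun k => ?_⟩
      · refine Filter.mem_of_superset (hU.diff_mem hA (hfin k)) fun i hi => ?_
        have hki : k ≤ κ i := not_lt.1 fun hlt => hi.2 ⟨hi.1, hlt⟩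
        have h1 : (g i + 1) * 2 ^ k ≤ (g i + 1) * 2 ^ κ i := by gcongr; norm_num
        refine (h1.trans (hκ i hi.1).1).trans (Finset.card_le_card fun j hj => ?_)
        simp only [fib, Finset.mem_filter, Finset.mem_range] at hj ⊢
        exact ⟨hj.1, by simpa [Y] using ⟨hi.1, hj⟩⟩
      · refine ((hfin k).biUnion fun i _ => (finite_Iio (N i)).image (Nat.pair i)).subset ?_
        rintro x ⟨⟨hxA, hxN, hxX⟩, hxk⟩
        refine mem_biUnion (x := x.unpair.1) ⟨hxA, not_le.1 fun hle => hxk (hX hle hxX)⟩ ?_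
        exact ⟨x.unpair.2, hxN, Nat.pair_unpair x⟩)
    (fun X Z hX => by
      have hcard : ∀ i, (fib X i).card = (fib (X ∩ Z) i).card + (fib (X \ Z) i).card := by
        intro i
        rw [← Finset.card_filter_add_card_filter_not (s := fib X i) (fun j => Nat.pair i j ∈ Z)]
        simp only [fib, Finset.filter_filter, mem_inter_iff, mem_sdiff]
      rcases U.mem_or_compl_mem {i | (fib X i).card ≤ 2 * (fib (X ∩ Z) i).card} with hh | hh
      · refine .inl fun k => Filter.mem_of_superset (Filter.inter_mem hh (hX (k + 1))) ?_
        rintro i ⟨h1, h2⟩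
        simp only [mem_ofPred_eq, pow_succ] at h1 h2 ⊢
        linarith
      · refine .inr fun k => Filter.mem_of_superset (Filter.inter_mem hh (hX (k + 1))) ?_
        rintro i ⟨h1, h2⟩
        simp only [mem_compl_iff, mem_ofPred_eq, pow_succ, not_le] at h1 h2 ⊢
        have := hcard i
        linarith)
    (fun _ _ => True) (fun _ X hX => ⟨X, Subset.rfl, hX, trivial⟩)
  have hlarge : ∀ Y ∈ W, {i | (g i : ℕ∞) < {y ∈ Y | y.unpair.1 = i}.encard} ∈ U := by
    refine fun Y hY => Filter.mem_of_superset (hWP Y hY 0) fun i hi =>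
      lt_of_lt_of_le ?_ (hencard Y i)
    have hi : (g i + 1) * 2 ^ 0 ≤ (fib Y i).card := hi
    exact_mod_cast (by omega : g i < (fib Y i).card)
  refine ⟨W, hW, fun x => x.unpair.1, Ultrafilter.eq_map_of_forall_preimage fun B hB => ?_, hlarge⟩
  refine Filter.mem_of_superset (hlarge _ hB) fun i hi => ?_
  obtain ⟨y, hy, rfl⟩ := nonempty_of_encard_ne_zero (ne_bot_of_gt hi)
  exact hy

theorem RKLE.refl (U : Ultrafilter ℕ) : RKLE U U := ⟨id, by simp⟩

theorem RKLE.trans {U V W : Ultrafilter ℕ} (h₁ : RKLE U V) (h₂ : RKLE V W) : RKLE U W := by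
  obtain ⟨f, rfl⟩ := h₁
  obtain ⟨g, rfl⟩ := h₂
  exact ⟨f ∘ g, by rw [Ultrafilter.map_map]⟩

/-- Every Rudin–Keisler projection of `W` to `S` has, on every member of `W`, a fiber with more
than `g j` elements over some point `j`. -/
def HasLargeFibersOver (g : ℕ → ℕ) (S W : Ultrafilter ℕ) : Prop :=
  ∀ q : ℕ → ℕ, S = Ultrafilter.map q W → ∀ Y ∈ W, ∃ j, (g j : ℕ∞) < {y ∈ Y | q y = j}.encard

theorem JensenDiamond.exists_isPPoint_hasLargeFibersOver (h : JensenDiamond)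
    {S U : Ultrafilter ℕ} (hS : IsPPoint S) (hSs : HasSparseMembers S) (hU : IsPPoint U)
    (hSU : RKLE S U) (g : ℕ → ℕ) :
    ∃ W, IsPPoint W ∧ RKLE U W ∧ HasLargeFibersOver g S W := by
  obtain ⟨q₀, hq₀⟩ := hSU
  obtain ⟨W, hW, π, hπ, hlarge⟩ := h.exists_isPPoint_large_fibers hU (g ∘ q₀)
  refine ⟨W, hW, ⟨π, hπ⟩, fun q hq Y hY => ?_⟩
  obtain ⟨X, hX, heq⟩ := hSs.eqOn_of_map_eq hS hW hq.symm
    (g := q₀ ∘ π) (by rw [← Ultrafilter.map_map, ← hπ, hq₀])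
  obtain ⟨i, hi⟩ := U.nonempty_of_mem (hlarge _ (Filter.inter_mem hY hX))
  refine ⟨q₀ i, lt_of_lt_of_le hi (encard_le_encard ?_)⟩
  rintro y ⟨⟨hyY, hyX⟩, rfl⟩
  exact ⟨hyY, heq y hyX⟩

/-- If `W` were the image of `V` under `r`, uniqueness of projections would make fibers of `W` over
`S` images under `r` of fibers of `V`, hence no larger. -/
theorem IsPPoint.exists_bound_not_hasLargeFibersOver {S V : Ultrafilter ℕ} (hV : IsPPoint V)
    (hS : IsPPoint S) (hSs : HasSparseMembers S) (hSV : RKLE S V) :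
    ∃ b : ℕ → ℕ, ∀ g, b ≤ g → ∀ W, RKLE S W → HasLargeFibersOver g S W → ¬ RKLE W V := by
  obtain ⟨f, hf⟩ := hSV
  obtain ⟨X, hX, hfin⟩ := hV.exists_finite_preimage hS.nonprincipal hf.symm
  refine ⟨fun j => {x ∈ X | f x = j}.ncard, ?_⟩
  rintro g hg W ⟨q, hq⟩ hlarge ⟨r, rfl⟩
  obtain ⟨X', hX', heq⟩ := hSs.eqOn_of_map_eq hS hV hf.symm
    (g := q ∘ r) (by rw [← Ultrafilter.map_map, hq])
  obtain ⟨j, hj⟩ := hlarge q hq (r '' (X ∩ X'))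
    (Filter.image_mem_map (Filter.inter_mem hX hX'))
  refine hj.not_ge ?_
  calc {y ∈ r '' (X ∩ X') | q y = j}.encard
      ≤ (r '' {x ∈ X | f x = j}).encard := by
        refine encard_le_encard ?_
        rintro _ ⟨⟨x, ⟨hx, hx'⟩, rfl⟩, hxj⟩
        exact ⟨x, ⟨hx, (heq x hx').trans hxj⟩, rfl⟩
    _ ≤ {x ∈ X | f x = j}.encard := encard_image_le _ _
    _ = {x ∈ X | f x = j}.ncard := (hfin j).cast_ncard_eq.symm
    _ ≤ g j := by exact_mod_cast hg j

/-! ### The unbounded chain -/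

theorem theorem4p4 (hdiamond : JensenDiamond) :
    ∃ U : OmegaOne → Ultrafilter ℕ,
      (∀ α, IsPPoint (U α)) ∧
      (∀ α β, α < β → RKLT (U α) (U β)) ∧
      ¬ ∃ V : Ultrafilter ℕ, IsPPoint V ∧ ∀ α, RKLE (U α) V := by
  obtain ⟨g, hg⟩ := hdiamond.exists_surjective (T := ℕ → ℕ) (by simp)
  obtain ⟨S, hS, hSs⟩ := hdiamond.exists_isPPoint_hasSparseMembers
  let Q := {U : Ultrafilter ℕ // IsPPoint U ∧ RKLE S U}
  have : Nonempty Q := ⟨⟨S, hS, .refl S⟩⟩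
  obtain ⟨p, hp⟩ := exists_chain (Q := Q) OmegaOne.countable_Iio (fun U W => RKLE U.1 W.1)
    (fun U => .refl U.1) (fun _ _ _ => RKLE.trans)
    (fun s hs => by
      obtain ⟨W, hW, hle⟩ := hdiamond.exists_isPPoint_bound (fun n => (s n).2.1) hs
      exact ⟨⟨W, hW, (s 0).2.2.trans (hle 0)⟩, hle⟩)
    (fun i U W => ¬ RKLE W.1 U.1 ∧ HasLargeFibersOver (g i) S W.1)
    (fun i U => by
      obtain ⟨b, hb⟩ := U.2.1.exists_bound_not_hasLargeFibersOver hS hSs U.2.2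
      obtain ⟨W, hW, hUW, hlarge⟩ := hdiamond.exists_isPPoint_hasLargeFibersOver hS hSs
        -- Exceeding `b` makes the step strict; exceeding `g i` serves the enumeration.
        U.2.1 U.2.2 (b ⊔ g i)
      refine ⟨⟨W, hW, U.2.2.trans hUW⟩, hUW,
        hb _ le_sup_left W (U.2.2.trans hUW) hlarge, fun q hq Y hY => ?_⟩
      obtain ⟨j, hj⟩ := hlarge q hq Y hY
      exact ⟨j, lt_of_le_of_lt (by simp) hj⟩)
  refine ⟨fun i => (p i).1, fun i => (p i).2.1, fun i j hij => ?_, ?_⟩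
  · obtain ⟨q, hlt, hle, hnle, -⟩ := hp j
    exact ⟨(hlt i hij).trans hle, fun hc => hnle (hc.trans (hlt i hij))⟩
  · rintro ⟨V, hV, hle⟩
    have hSV : RKLE S V := (p ⟨0, Ordinal.omega_pos 1⟩).2.2.trans (hle _)
    obtain ⟨b, hb⟩ := hV.exists_bound_not_hasLargeFibersOver hS hSs hSV
    obtain ⟨i, rfl⟩ := hg b
    obtain ⟨q, -, -, -, hlarge⟩ := hp i
    exact hb _ le_rfl _ (p i).2.2 hlarge (hle i)
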